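/- Let $d\ge 1$, let $\mathcal X\subset\mathbb R^d$ be compact and convex with non-empty interior, and let $\mathcal D$ be the Euclidean distance. For a finite group $\mathcal G$ of Euclidean isometries $g$ of $\mathbb R^d$ with $g(\mathcal X)=\mathcal X$, an instance of the invariant Lipschitz bandit problem on $\mathcal X$ with respect to $\mathcal G$ assigns (measurably) to each arm $x\in\mathcal X$ a reward distribution $\mathbb P_x$ on $[0,1]$ whose mean $f(x)$ satisfies $|f(x)-f(x')|\le \mathcal D(x,x')$ and $f(g\cdot x)=f(x)$ for all $x,x'\in\mathcal X$ and $g\in\mathcal G$. In each round $t=1,\dots,n$ a (possibly randomized) bandit strategy chooses an arm $X_t\in\mathcal X$ on the basis of the arms and rewards of the earlier rounds, and then a reward is drawn from $\mathbb P_{X_t}$, independently of the past given $X_t$; its regret is $\mathbf R_n=\mathbb E\big[\sum_{t=1}^n (f^*-f(X_t))\big]$ with $f^*=\sup_{\mathcal X} f$. There are constants $c,C>0$, depending only on $\mathcal X$ (and so on $d$), such that for every such group $\mathcal G$, every horizon $n\ge C|\mathcal G|^{d+1}$ and every bandit strategy (which may depend on $\mathcal G$ and $n$) there is an instance of the invariant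 Lipschitz bandit problem on $\mathcal X$ with respect to $\mathcal G$ on which the strategy suffers regret $$\mathbf R_n\ \ge\ c\,\Big(\frac1{|\mathcal G|}\Big)^{\frac1{d+2}}\, n^{\frac{d+1}{d+2}} .$$ -/

import Mathlib

open MeasureTheory ProbabilityTheory

/-- The symmetry group of `X ⊆ E^d`: all Euclidean isometries `φ` of `E^d` with `φ(X) = X`. -/
def euclideanSymmetryGroup {d : ℕ} (X : Set (EuclideanSpace ℝ (Fin d))) :
    Subgroup (EuclideanSpace ℝ (Fin d) ≃ᵢ EuclideanSpace ℝ (Fin d)) where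
  carrier := {φ | φ '' X = X}
  one_mem' := by simp
  mul_mem' := by
    intro φ ψ hφ hψ
    simp only [Set.mem_ofPred_eq, IsometryEquiv.coe_mul, Set.image_comp] at *
    rw [hψ, hφ]
  inv_mem' := by
    intro φ hφ
    simp only [Set.mem_ofPred_eq] at *
    conv_lhs => rw [← hφ]
    rw [← Set.image_comp]
    simp

namespace Bandit

/-- The rewards: an environment with arm set `A` is a Markov kernel `ν` from `A` to `[0,1]`, where
`ν x` is the law of the reward of arm `x`. This is its expected reward function. -/
noncomputable def meanReward {A : Type*} [MeasurableSpace A] (ν : Kernel A unitInterval) (x : A) :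
    ℝ :=
  ∫ y, (y : ℝ) ∂(ν x)

/-- A (possibly randomized) bandit strategy: after `t` rounds, the next arm is drawn from a law that
depends measurably on the arms and rewards of these rounds. When the horizon `n` is fixed, only the
decisions `policy t` with `t < n` matter. -/
structure Strategy (A : Type*) [MeasurableSpace A] where
  /-- the law of the arm of round `t` (counted from `0`) given the history of rounds `0, …, t-1` -/
  policy : (t : ℕ) → Kernel (Fin t → A × unitInterval) A
  /-- each decision is a probability measure on the set of arms -/
  isMarkov : ∀ t, IsMarkovKernel (policy t)

/-- The law of the first `t` pairs (arm, reward) when the strategy `S` is used in the environment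
`ν`: the arm of round `t` is drawn from `S.policy t` given the past, and then the reward is drawn
from the law that `ν` assigns to this arm, independently of the past. -/
noncomputable def historyLaw {A : Type*} [MeasurableSpace A] (ν : Kernel A unitInterval)
    (S : Strategy A) : (t : ℕ) → Measure (Fin t → A × unitInterval)
  | 0 => Measure.dirac Fin.elim0
  | t + 1 =>
      Measure.map (fun p : (Fin t → A × unitInterval) × (A × unitInterval) =>
          (Fin.snoc p.1 p.2 : Fin (t + 1) → A × unitInterval))
        (historyLaw ν S t ⊗ₘ
          (S.policy t ⊗ₖ Kernel.prodMkLeft (Fin t → A × unitInterval) ν))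

/-- The expected regret `𝔼 [∑ₜ (f* - f(Xₜ))]` of `S` over `n` rounds in the environment `ν`, where
`f` is the expected reward function and `f* = sup f`. -/
noncomputable def regret {A : Type*} [MeasurableSpace A] (ν : Kernel A unitInterval)
    (S : Strategy A) (n : ℕ) : ℝ :=
  ∫ h, ∑ t : Fin n, ((⨆ x, meanReward ν x) - meanReward ν (h t).1) ∂(historyLaw ν S n)

/-- The environments of the invariant Lipschitz bandit problem on `X` with respect to `G`: the
rewards are `[0,1]`-valued and the expected reward function is `1`-Lipschitz and `G`-invariant. -/
structure IsInvariantLipschitz {d : ℕ} (X : Set (EuclideanSpace ℝ (Fin d)))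
    (G : Subgroup (EuclideanSpace ℝ (Fin d) ≃ᵢ EuclideanSpace ℝ (Fin d)))
    (ν : Kernel X unitInterval) : Prop where
  isMarkov : IsMarkovKernel ν
  lipschitz : ∀ x y : X, |meanReward ν x - meanReward ν y| ≤ dist x y
  invariant : ∀ g ∈ G, ∀ x y : X, (y : EuclideanSpace ℝ (Fin d)) = g x →
    meanReward ν y = meanReward ν x

end Bandit

/-! The lower bound comes from hiding one bump among many. A bump of height `δ` with unit slope is
placed around a whole `G`-orbit, so it is invariant and `1`-Lipschitz. By volume, about `K ≈ δ ^
(-d) / |G|` orbits fit with disjoint bumps. Under fair coin rewards some bump is visited in at most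
a fraction `1 / K` of the rounds on average. If `n * δ ^ 2` is at most a small multiple of `K`, the
observations made there cannot reveal it, so the strategy loses a constant fraction of `n * δ`.
Balancing gives `δ ≈ (n * |G|) ^ (-1 / (d + 2))`, hence the rate.

Indistinguishability is proved by a second moment bound on the likelihood ratio:
`one_add_sum_sub_le_prod` bounds it below pointwise, and orthogonality of the increments controls
the error (`integral_historyLaw_bernoulliKernel_ge`). `exists_regret_ge` selects the neglected bump;
`exists_separated_orbits` supplies the orbits. -/

namespace Bandit

variable {A : Type*} [MeasurableSpace A]

/-- The environment in which the reward of arm `x` is `1` with probability `1 / 2 + f x` and `0`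
otherwise. -/
noncomputable def bernoulliKernel (f : A → ℝ) (hf : Measurable f) : Kernel A unitInterval where
  toFun x := ENNReal.ofReal (1 / 2 + f x) • Measure.dirac 1 +
    ENNReal.ofReal (1 / 2 - f x) • Measure.dirac 0
  measurable' := by
    refine Measure.measurable_of_measurable_coe _ fun s hs => ?_
    simp only [Measure.coe_add, Measure.coe_smul, Pi.add_apply, Pi.smul_apply, smul_eq_mul]
    fun_prop

lemma lintegral_bernoulliKernel {f : A → ℝ} (hf : Measurable f) (x : A)
    (F : unitInterval → ENNReal) :
    ∫⁻ y, F y ∂(bernoulliKernel f hf x) =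
      ENNReal.ofReal (1 / 2 + f x) * F 1 + ENNReal.ofReal (1 / 2 - f x) * F 0 := by
  change ∫⁻ y, F y ∂(ENNReal.ofReal (1 / 2 + f x) • Measure.dirac 1 +
    ENNReal.ofReal (1 / 2 - f x) • Measure.dirac 0) = _
  simp [lintegral_add_measure, lintegral_smul_measure]

lemma isMarkovKernel_bernoulliKernel {f : A → ℝ} (hf : Measurable f) (h : ∀ x, |f x| ≤ 1 / 2) :
    IsMarkovKernel (bernoulliKernel f hf) := by
  refine ⟨fun x => ⟨?_⟩⟩
  have hx := abs_le.1 (h x)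
  rw [← lintegral_one, lintegral_bernoulliKernel, mul_one, mul_one,
    ← ENNReal.ofReal_add (by linarith) (by linarith)]
  norm_num

lemma meanReward_bernoulliKernel {f : A → ℝ} (hf : Measurable f) (h : ∀ x, |f x| ≤ 1 / 2) (x : A) :
    meanReward (bernoulliKernel f hf) x = 1 / 2 + f x := by
  have hx := abs_le.1 (h x)
  rw [meanReward, integral_eq_lintegral_of_nonneg_ae (.of_forall fun y => y.2.1)
    (by fun_prop), lintegral_bernoulliKernel]
  simp only [Set.Icc.coe_one, Set.Icc.coe_zero, ENNReal.ofReal_one, ENNReal.ofReal_zero, mul_one,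
    mul_zero, add_zero]
  exact ENNReal.toReal_ofReal (by linarith)

instance (S : Strategy A) (t : ℕ) : IsMarkovKernel (S.policy t) := S.isMarkov t

lemma measurable_snoc (t : ℕ) : Measurable fun p : (Fin t → A × unitInterval) × (A × unitInterval) =>
    (Fin.snoc p.1 p.2 : Fin (t + 1) → A × unitInterval) := by
  refine measurable_pi_lambda _ fun i => ?_
  refine Fin.lastCases ?_ (fun j => ?_) i
  · simpa using measurable_snd
  · simpa using! (measurable_pi_apply j).comp measurable_fst

instance isProbabilityMeasure_historyLaw (ν : Kernel A unitInterval) [IsMarkovKernel ν]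
    (S : Strategy A) (t : ℕ) : IsProbabilityMeasure (historyLaw ν S t) := by
  induction t with
  | zero => rw [historyLaw]; infer_instance
  | succ t ih =>
    rw [historyLaw]
    exact Measure.isProbabilityMeasure_map (measurable_snoc t).aemeasurable

lemma lintegral_historyLaw_succ (ν : Kernel A unitInterval) [IsMarkovKernel ν] (S : Strategy A)
    (t : ℕ) {F : (Fin (t + 1) → A × unitInterval) → ENNReal} (hF : Measurable F) :
    ∫⁻ h, F h ∂(historyLaw ν S (t + 1)) =
      ∫⁻ h, ∫⁻ x, ∫⁻ y, F (Fin.snoc h (x, y)) ∂(ν x) ∂(S.policy t h) ∂(historyLaw ν S t) := by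
  have hm : Measurable fun p : (Fin t → A × unitInterval) × (A × unitInterval) =>
    F (Fin.snoc p.1 p.2) := hF.comp (measurable_snoc t)
  rw [historyLaw, lintegral_map hF (measurable_snoc t), Measure.lintegral_compProd hm]
  refine lintegral_congr fun h => ?_
  rw [Kernel.lintegral_compProd _ _ _ (by exact hm.comp measurable_prodMk_left)]
  simp

/-! ### Likelihood ratios and change of measure -/

/-- The relative increment of the likelihood ratio of the Bernoulli environments of mean
`1 / 2 + f` and of mean `1 / 2`. -/
def likelihoodIncrement (f : A → ℝ) (a : A × unitInterval) : ℝ := 2 * f a.1 * (2 * (a.2 : ℝ) - 1)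

@[fun_prop]
lemma measurable_likelihoodIncrement {f : A → ℝ} (hf : Measurable f) :
    Measurable (likelihoodIncrement f) := by
  unfold likelihoodIncrement
  fun_prop

lemma abs_likelihoodIncrement_le {B : Type*} {f : B → ℝ} (a : B × unitInterval) :
    |likelihoodIncrement f a| ≤ 2 * |f a.1| := by
  rw [likelihoodIncrement, abs_mul, abs_mul, abs_two]
  have h := a.2.2
  have : |2 * (a.2 : ℝ) - 1| ≤ 1 := abs_le.2 ⟨by linarith [h.1], by linarith [h.2]⟩
  exact mul_le_of_le_one_right (by positivity) this

/-- The likelihood ratio of a Bernoulli environment with respect to the fair one. -/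
lemma lintegral_historyLaw_bernoulliKernel {f : A → ℝ} (hf : Measurable f)
    (h : ∀ x, |f x| ≤ 1 / 4) (S : Strategy A) (t : ℕ) {F : (Fin t → A × unitInterval) → ENNReal}
    (hF : Measurable F) :
    ∫⁻ p, F p ∂(historyLaw (bernoulliKernel f hf) S t) =
      ∫⁻ p, ENNReal.ofReal (∏ s, (1 + likelihoodIncrement f (p s))) * F p
        ∂(historyLaw (bernoulliKernel (fun _ : A => 0) measurable_const) S t) := by
  have := isMarkovKernel_bernoulliKernel hf fun x => (h x).trans (by norm_num)
  have := isMarkovKernel_bernoulliKernel (A := A) (f := fun _ => 0) measurable_const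
    fun x => by norm_num
  induction t with
  | zero => simp [historyLaw]
  | succ t ih =>
    have hG (ν : Kernel A unitInterval) [IsMarkovKernel ν] :
        Measurable fun p => ∫⁻ x, ∫⁻ y, F (Fin.snoc p (x, y)) ∂(ν x) ∂(S.policy t p) := by
      have hm : Measurable fun p : (Fin t → A × unitInterval) × (A × unitInterval) =>
        F (Fin.snoc p.1 p.2) := hF.comp (measurable_snoc t)
      have : (fun p => ∫⁻ x, ∫⁻ y, F (Fin.snoc p (x, y)) ∂(ν x) ∂(S.policy t p)) =
          fun p => ∫⁻ a, F (Fin.snoc p a)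
            ∂((S.policy t ⊗ₖ Kernel.prodMkLeft (Fin t → A × unitInterval) ν) p) := by
        ext p
        rw [Kernel.lintegral_compProd _ _ _ (by exact hm.comp measurable_prodMk_left)]
        simp
      rw [this]
      exact Measurable.lintegral_kernel_prod_right hm
    rw [lintegral_historyLaw_succ _ _ _ hF, ih (hG _), lintegral_historyLaw_succ _ _ _ (by fun_prop)]
    refine lintegral_congr fun p => ?_
    rw [← lintegral_const_mul' _ _ ENNReal.ofReal_ne_top]
    refine lintegral_congr fun x => ?_
    have hx := abs_le.1 (h x)
    have hL : 0 ≤ ∏ s, (1 + likelihoodIncrement f (p s)) := Finset.prod_nonneg fun s _ => by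
      have := abs_le.1 (abs_likelihoodIncrement_le (f := f) (p s))
      linarith [h (p s).1]
    -- The masses `1 / 2 ± f x` are `1 / 2` times `1 ± 2 * f x`, the last factor of the product at
    -- rewards `1` and `0`.
    rw [lintegral_bernoulliKernel, lintegral_bernoulliKernel]
    simp only [Fin.prod_univ_castSucc, Fin.snoc_castSucc, Fin.snoc_last, likelihoodIncrement,
      Set.Icc.coe_one, Set.Icc.coe_zero]
    rw [mul_add, ← mul_assoc, ← mul_assoc, ← mul_assoc, ← mul_assoc]
    simp only [likelihoodIncrement] at hL
    rw [← ENNReal.ofReal_mul hL, ← ENNReal.ofReal_mul hL, ← ENNReal.ofReal_mul (by norm_num),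
      ← ENNReal.ofReal_mul (by norm_num)]
    congr 3 <;> ring

/-- The increments are orthogonal in the fair environment. -/
lemma lintegral_sq_sum_likelihoodIncrement {f : A → ℝ} (hf : Measurable f) (S : Strategy A)
    (t : ℕ) :
    ∫⁻ p, ENNReal.ofReal ((∑ s, likelihoodIncrement f (p s)) ^ 2)
        ∂(historyLaw (bernoulliKernel (fun _ : A => 0) measurable_const) S t) =
      ∫⁻ p, ENNReal.ofReal (∑ s, 4 * f (p s).1 ^ 2)
        ∂(historyLaw (bernoulliKernel (fun _ : A => 0) measurable_const) S t) := by
  have := isMarkovKernel_bernoulliKernel (A := A) (f := fun _ => 0) measurable_const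
    fun x => by norm_num
  induction t with
  | zero => simp
  | succ t ih =>
    have half : ENNReal.ofReal (1 / 2 : ℝ) + ENNReal.ofReal (1 / 2) = 1 := by
      rw [← ENNReal.ofReal_add (by norm_num) (by norm_num)]; norm_num
    rw [lintegral_historyLaw_succ _ _ _ (by fun_prop), lintegral_historyLaw_succ _ _ _ (by fun_prop)]
    simp only [lintegral_bernoulliKernel, Fin.sum_univ_castSucc, Fin.snoc_castSucc, Fin.snoc_last]
    -- The two equally likely rewards give opposite increments `± 2 * f x`, so the cross terms
    -- cancel.
    have h1 (p : Fin t → A × unitInterval) (x : A) :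
        ENNReal.ofReal (1 / 2 + 0) * ENNReal.ofReal
          ((∑ s, likelihoodIncrement f (p s) + likelihoodIncrement f (x, 1)) ^ 2) +
        ENNReal.ofReal (1 / 2 - 0) * ENNReal.ofReal
          ((∑ s, likelihoodIncrement f (p s) + likelihoodIncrement f (x, 0)) ^ 2) =
        ENNReal.ofReal ((∑ s, likelihoodIncrement f (p s)) ^ 2) +
          ENNReal.ofReal (4 * f x ^ 2) := by
      rw [← ENNReal.ofReal_mul (by norm_num), ← ENNReal.ofReal_mul (by norm_num),
        ← ENNReal.ofReal_add (by positivity) (by positivity),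
        ← ENNReal.ofReal_add (by positivity) (by positivity)]
      congr 1
      simp only [likelihoodIncrement, Set.Icc.coe_one, Set.Icc.coe_zero]
      ring
    have h2 (p : Fin t → A × unitInterval) (x : A) :
        ENNReal.ofReal (1 / 2 + 0) * ENNReal.ofReal (∑ s, 4 * f (p s).1 ^ 2 + 4 * f x ^ 2) +
        ENNReal.ofReal (1 / 2 - 0) * ENNReal.ofReal (∑ s, 4 * f (p s).1 ^ 2 + 4 * f x ^ 2) =
        ENNReal.ofReal (∑ s, 4 * f (p s).1 ^ 2) + ENNReal.ofReal (4 * f x ^ 2) := by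
      rw [← add_mul, add_zero, sub_zero, half, one_mul,
        ENNReal.ofReal_add (Finset.sum_nonneg fun s _ => by positivity) (by positivity)]
    simp only [h1, h2, lintegral_add_left measurable_const, lintegral_const, measure_univ, mul_one]
    rw [lintegral_add_left (by fun_prop), lintegral_add_left (by fun_prop), ih]

/-- Each factor satisfies `exp (w - 2 * w ^ 2) ≤ 1 + w` for `w ≥ -1 / 2`; multiply these and apply
`1 + u ≤ exp u` to the total exponent. -/
lemma one_add_sum_sub_le_prod {ι : Type*} (s : Finset ι) (w : ι → ℝ)
    (hw : ∀ i ∈ s, -(1 / 2) ≤ w i) :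
    1 + ∑ i ∈ s, w i - 2 * ∑ i ∈ s, w i ^ 2 ≤ ∏ i ∈ s, (1 + w i) := by
  have h1 : ∀ i ∈ s, Real.exp (w i - 2 * w i ^ 2) ≤ 1 + w i := fun i hi => by
    have h := hw i hi
    have h2 := Real.add_one_le_exp (-(w i - 2 * w i ^ 2))
    rw [Real.exp_neg] at h2
    have h3 : 0 < -(w i - 2 * w i ^ 2) + 1 := by nlinarith [sq_nonneg (w i - 1 / 4)]
    refine (le_inv_of_le_inv₀ h3 h2).trans ?_
    rw [inv_le_iff_one_le_mul₀ h3]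
    -- `(1 + w) * (1 - w + 2 * w ^ 2) = 1 + w ^ 2 * (1 + 2 * w)`.
    nlinarith [mul_nonneg (sq_nonneg (w i)) (by linarith : 0 ≤ 1 + 2 * w i)]
  have h2 := Finset.prod_le_prod (fun i _ => (Real.exp_pos _).le) h1
  rw [← Real.exp_sum, Finset.sum_sub_distrib, ← Finset.mul_sum] at h2
  linarith [Real.add_one_le_exp (∑ i ∈ s, w i - 2 * ∑ i ∈ s, w i ^ 2)]

/-- The law of the history in the environment in which all rewards are fair coin flips. -/
noncomputable abbrev fairHistoryLaw (S : Strategy A) (n : ℕ) : Measure (Fin n → A × unitInterval) :=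
  historyLaw (bernoulliKernel (fun _ : A => 0) measurable_const) S n

instance (S : Strategy A) (n : ℕ) : IsProbabilityMeasure (fairHistoryLaw S n) := by
  have := isMarkovKernel_bernoulliKernel (A := A) (f := fun _ => 0) measurable_const
    fun x => by norm_num
  infer_instance

lemma integrable_of_abs_le {α : Type*} [MeasurableSpace α] {μ : Measure α} [IsFiniteMeasure μ]
    {F : α → ℝ} (hF : Measurable F) {c : ℝ} (h : ∀ x, |F x| ≤ c) : Integrable F μ :=
  Integrable.of_bound hF.aestronglyMeasurable c (.of_forall h)

/-- A change of measure from a Bernoulli environment to the fair one: few observations of rewards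
that are not fair lead to a small bias. -/
lemma integral_historyLaw_bernoulliKernel_ge {f : A → ℝ} (hf : Measurable f) {δ : ℝ}
    (hδ : δ ≤ 1 / 4) (h0 : ∀ x, 0 ≤ f x) (h1 : ∀ x, f x ≤ δ) (S : Strategy A) (n : ℕ)
    {H : (Fin n → A × unitInterval) → ℝ} (hH : Measurable H) {B : ℝ} (hH0 : ∀ p, 0 ≤ H p)
    (hHB : ∀ p, H p ≤ B) :
    ∫ p, H p ∂(fairHistoryLaw S n) -
        B * (1 / 8 + 16 * δ * ∫ p, ∑ t, f (p t).1 ∂(fairHistoryLaw S n)) ≤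
      ∫ p, H p ∂(historyLaw (bernoulliKernel f hf) S n) := by
  set P := fairHistoryLaw S n with hP
  have habs (x : A) : |f x| ≤ 1 / 4 := by
    rw [abs_of_nonneg (h0 x)]; exact (h1 x).trans hδ
  have hw (a : A × unitInterval) : |likelihoodIncrement f a| ≤ 1 / 2 :=
    (abs_likelihoodIncrement_le a).trans (by linarith [habs a.1])
  set L : (Fin n → A × unitInterval) → ℝ := fun p => ∏ s, (1 + likelihoodIncrement f (p s)) with hL
  set W : (Fin n → A × unitInterval) → ℝ := fun p => ∑ s, likelihoodIncrement f (p s) with hW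
  set Q : (Fin n → A × unitInterval) → ℝ := fun p => ∑ s, 4 * f (p s).1 ^ 2 with hQ
  set T : (Fin n → A × unitInterval) → ℝ := fun p => ∑ s, f (p s).1 with hT
  have mL : Measurable L := by fun_prop
  have mW : Measurable W := by fun_prop
  have mQ : Measurable Q := by fun_prop
  have mT : Measurable T := by fun_prop
  have L0 (p) : 0 ≤ L p := Finset.prod_nonneg fun s _ => by linarith [(abs_le.1 (hw (p s))).1]
  -- A crude bound, needed only for integrability.
  have L1 (p) : L p ≤ 2 ^ n := by
    have := Finset.prod_le_prod (s := Finset.univ)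
      (fun s _ => (by linarith [(abs_le.1 (hw (p s))).1] : 0 ≤ 1 + likelihoodIncrement f (p s)))
      (fun s _ => (by linarith [(abs_le.1 (hw (p s))).2] :
        1 + likelihoodIncrement f (p s) ≤ 2))
    simpa using this
  have Q0 (p) : 0 ≤ Q p := Finset.sum_nonneg fun s _ => by positivity
  have T0 (p) : 0 ≤ T p := Finset.sum_nonneg fun s _ => h0 _
  have QT (p) : Q p ≤ 4 * δ * T p := by
    rw [hQ, hT, Finset.mul_sum]
    exact Finset.sum_le_sum fun s _ => by nlinarith [h0 (p s).1, h1 (p s).1]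
  have T1 (p) : T p ≤ n * (1 / 4) := by
    have := Finset.sum_le_card_nsmul Finset.univ (fun s => f (p s).1) (1 / 4)
      fun s _ => (h1 _).trans hδ
    simpa using this
  have W1 (p) : |W p| ≤ n * (1 / 2) := by
    refine (Finset.abs_sum_le_sum_abs _ _).trans ?_
    have := Finset.sum_le_card_nsmul Finset.univ (fun s => |likelihoodIncrement f (p s)|) (1 / 2)
      fun s _ => hw _
    simpa using this
  have WQ (p) : ∑ s, likelihoodIncrement f (p s) ^ 2 ≤ Q p :=
    Finset.sum_le_sum fun s _ => by
      have := abs_likelihoodIncrement_le (f := f) (p s)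
      rw [← sq_abs]
      have h3 := pow_le_pow_left₀ (abs_nonneg _) this 2
      rw [mul_pow, sq_abs (f _)] at h3
      linarith
  have iT : Integrable T P := integrable_of_abs_le mT fun p => by
    rw [abs_of_nonneg (T0 p)]; exact T1 p
  have iQ : Integrable Q P := (iT.const_mul (4 * δ)).mono' mQ.aestronglyMeasurable
    (.of_forall fun p => by rw [Real.norm_of_nonneg (Q0 p)]; exact QT p)
  have iW : Integrable (fun p => W p ^ 2) P := integrable_of_abs_le (by fun_prop) fun p => by
    rw [abs_of_nonneg (sq_nonneg _), ← sq_abs]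
    exact pow_le_pow_left₀ (abs_nonneg _) (W1 p) 2
  have iH : Integrable H P := integrable_of_abs_le hH fun p => by
    rw [abs_of_nonneg (hH0 p)]; exact hHB p
  have iLH : Integrable (fun p => L p * H p) P := integrable_of_abs_le (by fun_prop) fun p => by
    rw [abs_of_nonneg (mul_nonneg (L0 p) (hH0 p))]
    exact mul_le_mul (L1 p) (hHB p) (hH0 p) (by positivity)
  have hWQ : ∫ p, W p ^ 2 ∂P = ∫ p, Q p ∂P := by
    rw [integral_eq_lintegral_of_nonneg_ae (.of_forall fun p => sq_nonneg _)
      iW.aestronglyMeasurable, integral_eq_lintegral_of_nonneg_ae (.of_forall Q0)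
      iQ.aestronglyMeasurable]
    exact congrArg _ (lintegral_sq_sum_likelihoodIncrement hf S n)
  have hQT : ∫ p, Q p ∂P ≤ 4 * δ * ∫ p, T p ∂P := by
    rw [← integral_const_mul]
    exact integral_mono iQ (iT.const_mul _) QT
  have hchange : ∫ p, H p ∂(historyLaw (bernoulliKernel f hf) S n) = ∫ p, L p * H p ∂P := by
    rw [integral_eq_lintegral_of_nonneg_ae (.of_forall hH0) hH.aestronglyMeasurable,
      integral_eq_lintegral_of_nonneg_ae (.of_forall fun p => mul_nonneg (L0 p) (hH0 p))
      iLH.aestronglyMeasurable,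
      lintegral_historyLaw_bernoulliKernel hf habs S n (by fun_prop)]
    congr 1
    exact lintegral_congr fun p => (ENNReal.ofReal_mul (L0 p)).symm
  -- The linear term is absorbed by `W ≥ -1 / 8 - 2 * W ^ 2`, that is `2 * (W + 1 / 4) ^ 2 ≥ 0`.
  -- Then `L ≥ 1 - ε` gives `L * H ≥ H - ε * B`, since `0 ≤ H ≤ B` and `ε ≥ 0`.
  have key (p) : H p - B * (1 / 8 + 2 * W p ^ 2 + 2 * Q p) ≤ L p * H p := by
    have h2 := one_add_sum_sub_le_prod Finset.univ (fun s => likelihoodIncrement f (p s))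
      fun s _ => (abs_le.1 (hw (p s))).1
    have h3 : 1 - (1 / 8 + 2 * W p ^ 2 + 2 * Q p) ≤ L p := by
      have := WQ p
      simp only [hL, hW] at *
      nlinarith [sq_nonneg (∑ s, likelihoodIncrement f (p s) + 1 / 4)]
    have h4 : 0 ≤ 1 / 8 + 2 * W p ^ 2 + 2 * Q p := by have := Q0 p; positivity
    nlinarith [mul_le_mul_of_nonneg_right h3 (hH0 p), mul_le_mul_of_nonneg_right (hHB p) h4]
  have hB : 0 ≤ B := by
    obtain ⟨p⟩ : Nonempty (Fin n → A × unitInterval) := nonempty_of_isProbabilityMeasure P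
    exact (hH0 p).trans (hHB p)
  have iD : Integrable (fun p => 1 / 8 + 2 * W p ^ 2 + 2 * Q p) P :=
    ((integrable_const (1 / 8 : ℝ)).add (iW.const_mul 2)).add (iQ.const_mul 2)
  rw [hchange]
  refine le_trans ?_ (integral_mono (iH.sub (iD.const_mul B)) iLH key)
  have e : ∫ p, H p - B * (1 / 8 + 2 * W p ^ 2 + 2 * Q p) ∂P =
      ∫ p, H p ∂P - B * (1 / 8 + 2 * ∫ p, W p ^ 2 ∂P + 2 * ∫ p, Q p ∂P) := by
    rw [integral_sub iH (iD.const_mul B), integral_const_mul,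
      integral_add (f := fun p => 1 / 8 + 2 * W p ^ 2)
        ((integrable_const (1 / 8 : ℝ)).add (iW.const_mul 2)) (iQ.const_mul 2),
      integral_add (integrable_const (1 / 8 : ℝ)) (iW.const_mul 2), integral_const_mul,
      integral_const_mul]
    simp
  refine le_trans ?_ e.ge
  -- Now `2 * ∫ W ^ 2 + 2 * ∫ Q = 4 * ∫ Q ≤ 16 * δ * ∫ T`.
  rw [hWQ]
  have : B * ∫ p, Q p ∂P ≤ B * (4 * δ * ∫ p, T p ∂P) := mul_le_mul_of_nonneg_left hQT hB
  linarith

/-! ### Regret from disjoint bumps -/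

/-- If `K` bumps of height `δ` have disjoint supports, then every strategy misses the bump for too
many rounds in one of the corresponding environments. -/
lemma exists_regret_ge {ι : Type*} {s : Finset ι} (f : ι → A → ℝ) (hf : ∀ i, Measurable (f i))
    {δ : ℝ} (hδ : δ ≤ 1 / 4) (h0 : ∀ i x, 0 ≤ f i x)
    (hmax : ∀ i ∈ s, ∃ x, f i x = δ) (hle : ∀ i x, f i x ≤ δ)
    (hsum : ∀ x, ∑ i ∈ s, f i x ≤ δ) (hs : 4 ≤ s.card) (S : Strategy A) (n : ℕ)
    (hn : n * δ ^ 2 ≤ s.card / 128) :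
    ∃ i ∈ s, n * δ / 4 ≤ regret (bernoulliKernel (f i) (hf i)) S n := by
  set P := fairHistoryLaw S n with hP
  set T : ι → (Fin n → A × unitInterval) → ℝ := fun i p => ∑ t, f i (p t).1 with hT
  have hs0 : s.Nonempty := Finset.card_pos.1 (by omega)
  have hδ0 : 0 ≤ δ := by
    obtain ⟨i, hi⟩ := hs0
    obtain ⟨x, hx⟩ := hmax i hi
    exact hx ▸ h0 i x
  have hcard : (4 : ℝ) ≤ s.card := by exact_mod_cast hs
  have mT (i) : Measurable (T i) := by
    have := hf i
    fun_prop
  have T0 (i p) : 0 ≤ T i p := Finset.sum_nonneg fun t _ => h0 i _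
  have T1 (i p) : T i p ≤ n * δ := by
    have := Finset.sum_le_card_nsmul Finset.univ (fun t => f i (p t).1) δ fun t _ => hle i _
    simpa using this
  have iT (i) : Integrable (T i) P := integrable_of_abs_le (mT i) fun p => by
    rw [abs_of_nonneg (T0 i p)]; exact T1 i p
  -- Pigeonhole: the bumps sum to at most `δ` at each arm, so the expected totals `∫ T i` sum to at
  -- most `n * δ`.
  obtain ⟨i, his, hi⟩ : ∃ i ∈ s, ∫ p, T i p ∂P ≤ n * δ / s.card := by
    refine Finset.exists_le_of_sum_le hs0 ?_
    rw [← integral_finsetSum _ fun i _ => iT i, Finset.sum_const, nsmul_eq_mul,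
      mul_div_cancel₀ _ (by positivity)]
    have : ∀ p, ∑ i ∈ s, T i p ≤ n * δ := fun p => by
      simp only [hT]
      rw [Finset.sum_comm]
      have := Finset.sum_le_card_nsmul Finset.univ (fun t => ∑ i ∈ s, f i (p t).1) δ
        fun t _ => hsum _
      simpa using this
    simpa using integral_mono (integrable_finsetSum s fun i _ => iT i) (integrable_const _) this
  refine ⟨i, his, ?_⟩
  have habs (x : A) : |f i x| ≤ 1 / 2 := by
    rw [abs_of_nonneg (h0 i x)]; linarith [hle i x]
  have hsup : ⨆ x, meanReward (bernoulliKernel (f i) (hf i)) x = 1 / 2 + δ := by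
    simp only [meanReward_bernoulliKernel (hf i) habs]
    obtain ⟨x, hx⟩ := hmax i his
    refine IsGreatest.csSup_eq ⟨⟨x, by simp [hx]⟩, ?_⟩
    rintro _ ⟨y, rfl⟩
    simpa using hle i y
  have hreg : regret (bernoulliKernel (f i) (hf i)) S n =
      ∫ p, (n * δ - T i p) ∂(historyLaw (bernoulliKernel (f i) (hf i)) S n) := by
    rw [regret, hsup]
    simp only [meanReward_bernoulliKernel (hf i) habs, add_sub_add_left_eq_sub,
      Finset.sum_sub_distrib]
    simp [hT]
  have hmain := integral_historyLaw_bernoulliKernel_ge (hf i) hδ (h0 i) (hle i) S n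
    (H := fun p => n * δ - T i p) (B := n * δ) (by have := mT i; fun_prop)
    (fun p => by linarith [T1 i p]) (fun p => by linarith [T0 i p])
  rw [hreg]
  refine le_trans ?_ hmain
  rw [integral_sub (integrable_const _) (iT i)]
  simp only [integral_const, probReal_univ, one_smul]
  have hnδ : 0 ≤ n * δ := by positivity
  -- Out of `n * δ`, at most a quarter is collected in the fair environment and at most a quarter is
  -- lost in the change of measure.
  have h1 : n * δ / s.card ≤ n * δ / 4 := by gcongr
  have h2 : 16 * δ * ∫ p, T i p ∂P ≤ 1 / 8 := by
    calc 16 * δ * ∫ p, T i p ∂P ≤ 16 * δ * (n * δ / s.card) := by gcongr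
      _ = 16 * (n * δ ^ 2) / s.card := by ring
      _ ≤ 16 * (s.card / 128) / s.card := by gcongr
      _ = 1 / 8 := by field_simp; norm_num
  have h3 : n * δ * (1 / 8 + 16 * δ * ∫ p, T i p ∂P) ≤ n * δ * (1 / 4) := by
    gcongr; linarith
  linarith [hi]

end Bandit

/-! ### Invariant bumps and packing of orbits -/

section OrbitBump

variable {E : Type*} [PseudoMetricSpace E] (G : Subgroup (E ≃ᵢ E))

/-- The bump of height `δ` around the orbit of `p` under a group of isometries. -/
noncomputable def orbitBump (δ : ℝ) (p x : E) : ℝ :=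
  max 0 (δ - Metric.infDist x (Set.range fun g : G => (g : E ≃ᵢ E) p))

lemma orbitBump_nonneg (δ : ℝ) (p x : E) : 0 ≤ orbitBump G δ p x := le_max_left _ _

lemma orbitBump_le {δ : ℝ} (hδ : 0 ≤ δ) (p x : E) : orbitBump G δ p x ≤ δ :=
  max_le hδ (sub_le_self δ Metric.infDist_nonneg)

lemma orbitBump_self {δ : ℝ} (hδ : 0 ≤ δ) (p : E) : orbitBump G δ p p = δ := by
  have h : p ∈ Set.range fun g : G => (g : E ≃ᵢ E) p := ⟨1, rfl⟩
  rw [orbitBump, Metric.infDist_zero_of_mem h, sub_zero, max_eq_right hδ]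

lemma abs_orbitBump_sub_le (δ : ℝ) (p x y : E) :
    |orbitBump G δ p x - orbitBump G δ p y| ≤ dist x y := by
  have h := (Metric.lipschitz_infDist_pt (Set.range fun g : G => (g : E ≃ᵢ E) p)).dist_le_mul y x
  refine (abs_max_sub_max_le_max _ _ _ _).trans (max_le (by simp) ?_)
  rw [sub_sub_sub_cancel_left, dist_comm x]
  simpa [Real.dist_eq] using h

lemma continuous_orbitBump (δ : ℝ) (p : E) : Continuous (orbitBump G δ p) :=
  continuous_const.max (continuous_const.sub (Metric.continuous_infDist_pt _))

lemma orbitBump_apply {g : E ≃ᵢ E} (hg : g ∈ G) (δ : ℝ) (p x : E) :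
    orbitBump G δ p (g x) = orbitBump G δ p x := by
  have h : Set.range (fun g : G => (g : E ≃ᵢ E) p) =
      g '' Set.range (fun g : G => (g : E ≃ᵢ E) p) := by
    rw [← Set.range_comp]
    exact ((Equiv.mulLeft (⟨g, hg⟩ : G)).surjective.range_comp
      (fun g : G => (g : E ≃ᵢ E) p)).symm
  rw [orbitBump, h, Metric.infDist_image g.isometry, orbitBump]

/-- A common point of both supports is within `δ` of some `g p` and some `k q`; applying `k⁻¹` puts
`(k⁻¹ * g) p` within less than `2 * δ` of `q`. -/
lemma orbitBump_eq_zero_or {δ : ℝ} {p q : E} (h : ∀ g ∈ G, 2 * δ ≤ dist (g p) q) (x : E) :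
    orbitBump G δ p x = 0 ∨ orbitBump G δ q x = 0 := by
  by_contra! hx
  have near (r : E) (hr : orbitBump G δ r x ≠ 0) : ∃ g ∈ G, dist x (g r) < δ := by
    have : Metric.infDist x (Set.range fun g : G => (g : E ≃ᵢ E) r) < δ := by
      by_contra! h'
      exact hr (max_eq_left (by linarith))
    obtain ⟨_, ⟨g, rfl⟩, hg⟩ := (Metric.infDist_lt_iff (Set.range_nonempty _)).1 this
    exact ⟨g, g.2, hg⟩
  obtain ⟨g, hg, hgx⟩ := near p hx.1
  obtain ⟨k, hk, hkx⟩ := near q hx.2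
  have h1 := h (k⁻¹ * g) (G.mul_mem (G.inv_mem hk) hg)
  have h2 : dist ((k⁻¹ * g) p) q = dist (g p) (k q) := by
    rw [← k.isometry.dist_eq]
    simp [IsometryEquiv.mul_apply]
  have := dist_triangle_left (g p) (k q) x
  linarith

lemma sum_orbitBump_le {δ : ℝ} (hδ : 0 ≤ δ) {s : Finset E}
    (hs : (s : Set E).Pairwise fun p q => ∀ g ∈ G, 2 * δ ≤ dist (g p) q) (x : E) :
    ∑ p ∈ s, orbitBump G δ p x ≤ δ := by
  by_cases h : ∃ p ∈ s, orbitBump G δ p x ≠ 0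
  · obtain ⟨p, hp, hpx⟩ := h
    rw [Finset.sum_eq_single_of_mem p hp fun q hq hqp =>
      (orbitBump_eq_zero_or G (hs hp hq hqp.symm) x).resolve_left hpx]
    exact orbitBump_le G hδ p x
  · push Not at h
    rwa [Finset.sum_eq_zero h]

/-- Greedy packing: a set that is too large to be covered by `k * |G|` balls contains `k` points
whose orbits are far from each other. -/
lemma exists_separated_orbits [MeasurableSpace E] [Finite G] {μ : Measure E} {X : Set E} {r : ℝ}
    (hr : 0 < r) {m : ENNReal} (hm : ∀ x, μ (Metric.ball x r) ≤ m) (k : ℕ)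
    (hk : k * (Nat.card G * m) < μ X) :
    ∃ s : Finset E, s.card = k ∧ (s : Set E) ⊆ X ∧
      (s : Set E).Pairwise fun p q => ∀ g ∈ G, r ≤ dist (g p) q := by
  classical
  induction k with
  | zero => exact ⟨∅, by simp⟩
  | succ k ih =>
    obtain ⟨s, hcard, hsX, hs⟩ := ih (lt_of_le_of_lt (by gcongr; simp) hk)
    have := Fintype.ofFinite G
    set U : Set E := ⋃ p ∈ s, ⋃ g : G, Metric.ball ((g : E ≃ᵢ E) p) r
    have hU : μ U ≤ k * (Nat.card G * m) := by
      calc μ U ≤ ∑ p ∈ s, μ (⋃ g : G, Metric.ball ((g : E ≃ᵢ E) p) r) :=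
            measure_biUnion_finset_le _ _
        _ ≤ ∑ p ∈ s, ∑ g : G, m := Finset.sum_le_sum fun p _ =>
            (measure_iUnion_fintype_le _ _).trans (Finset.sum_le_sum fun g _ => hm _)
        _ = k * (Nat.card G * m) := by simp [hcard]
    have hlt : μ U < μ X := lt_of_le_of_lt (hU.trans (by gcongr; simp)) hk
    obtain ⟨q, hqX, hqU⟩ : ∃ q ∈ X, q ∉ U := by
      by_contra! h
      exact hlt.not_ge (measure_mono h)
    simp only [U, Set.mem_iUnion, Metric.mem_ball, not_exists, not_lt, Subtype.forall] at hqU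
    have hqs : q ∉ s := fun h => by
      have := hqU q h 1 G.one_mem
      simp at this
      linarith
    refine ⟨insert q s, by rw [Finset.card_insert_of_notMem hqs, hcard], ?_, ?_⟩
    · rw [Finset.coe_insert]
      exact Set.insert_subset hqX hsX
    · rw [Finset.coe_insert]
      refine hs.insert fun p hp _ => ⟨fun g hg => ?_, fun g hg => ?_⟩
      · have h1 := hqU p hp g⁻¹ (G.inv_mem hg)
        have h2 : dist q (g⁻¹ p) = dist (g q) p := by
          rw [← g.isometry.dist_eq]
          simp
        rwa [h2] at h1
      · rw [dist_comm]
        exact hqU p hp g hg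

end OrbitBump

/-- A set of finite positive volume contains at least of the order of `δ ^ (-d) / |G|` points whose
`G`-orbits are `2 * δ`-separated. -/
lemma exists_card_separated_orbits {d : ℕ} {X : Set (EuclideanSpace ℝ (Fin d))}
    {v : ℝ} (hv : 0 < v) (hvX : volume X =
      ENNReal.ofReal (v * 2 ^ d) * volume (Metric.ball (0 : EuclideanSpace ℝ (Fin d)) 1))
    (G : Subgroup (EuclideanSpace ℝ (Fin d) ≃ᵢ EuclideanSpace ℝ (Fin d))) [Finite G]
    {δ : ℝ} (hδ : 0 < δ) (hδv : 8 * Nat.card G * δ ^ d ≤ v) :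
    ∃ s : Finset (EuclideanSpace ℝ (Fin d)), 4 ≤ s.card ∧
      v ≤ 2 * Nat.card G * δ ^ d * s.card ∧
      (s : Set (EuclideanSpace ℝ (Fin d))) ⊆ X ∧
      (s : Set (EuclideanSpace ℝ (Fin d))).Pairwise fun p q => ∀ g ∈ G, 2 * δ ≤ dist (g p) q := by
  have hN : (0 : ℝ) < Nat.card G := by exact_mod_cast Nat.card_pos
  set D : ℝ := Nat.card G * δ ^ d with hD
  have hDpos : 0 < D := by positivity
  have hz : 8 ≤ v / D := by rw [le_div_iff₀ hDpos]; linarith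
  -- Packing needs `k < v / D`; as `v / D ≥ 8`, rounding up half of it leaves room and keeps `k ≥
  -- 4`.
  set k := ⌈v / D / 2⌉₊ with hk
  have hk1 : v / D / 2 ≤ k := Nat.le_ceil _
  have hk2 : (k : ℝ) < v / D / 2 + 1 := Nat.ceil_lt_add_one (by positivity)
  have hkD : (k : ℝ) * D < v := by
    rw [← lt_div_iff₀ hDpos]; linarith
  obtain ⟨s, hcard, hsX, hs⟩ := exists_separated_orbits G (μ := volume) (X := X) (r := 2 * δ)
    (by positivity)
    (m := ENNReal.ofReal ((2 * δ) ^ d) * volume (Metric.ball (0 : EuclideanSpace ℝ (Fin d)) 1))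
    (fun x => by rw [Measure.addHaar_ball_of_pos _ _ (by positivity), finrank_euclideanSpace_fin]) k (by
      rw [hvX, ← mul_assoc, ← mul_assoc]
      refine ENNReal.mul_lt_mul_left (Metric.measure_ball_pos _ _ one_pos).ne'
        measure_ball_lt_top.ne ?_
      rw [← ENNReal.ofReal_natCast, ← ENNReal.ofReal_natCast (Nat.card G),
        ← ENNReal.ofReal_mul (by positivity), ← ENNReal.ofReal_mul (by positivity),
        ENNReal.ofReal_lt_ofReal_iff (by positivity)]
      calc (k : ℝ) * Nat.card G * (2 * δ) ^ d = k * D * 2 ^ d := by rw [hD]; ring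
        _ < v * 2 ^ d := by gcongr)
  refine ⟨s, ?_, ?_, hsX, hs⟩
  · rw [hcard]
    exact_mod_cast (show (4 : ℝ) ≤ k by linarith)
  · rw [hcard]
    rw [div_div, div_le_iff₀ (by positivity)] at hk1
    linarith

/-! ### Choice of the scale and conclusion -/

theorem theorem2 (d : ℕ) (hd : 1 ≤ d) (X : Set (EuclideanSpace ℝ (Fin d)))
    (hcompact : IsCompact X) (hconvex : Convex ℝ X) (hint : (interior X).Nonempty) :
    ∃ c C : ℝ, 0 < c ∧ 0 < C ∧
      ∀ G : Subgroup (EuclideanSpace ℝ (Fin d) ≃ᵢ EuclideanSpace ℝ (Fin d)),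
        Finite G → G ≤ euclideanSymmetryGroup X →
        ∀ n : ℕ, C * (Nat.card G : ℝ) ^ (d + 1) ≤ (n : ℝ) →
        ∀ S : Bandit.Strategy X, ∃ ν : Kernel X unitInterval,
          Bandit.IsInvariantLipschitz X G ν ∧
          c * (1 / (Nat.card G : ℝ)) ^ ((1 : ℝ) / ((d : ℝ) + 2)) *
              (n : ℝ) ^ (((d : ℝ) + 1) / ((d : ℝ) + 2)) ≤
            Bandit.regret ν S n := by
  have hXpos : 0 < volume X :=
    (isOpen_interior.measure_pos volume hint).trans_le (measure_mono interior_subset)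
  have hω := Metric.measure_ball_pos volume (0 : EuclideanSpace ℝ (Fin d)) one_pos
  have hω' : volume (Metric.ball (0 : EuclideanSpace ℝ (Fin d)) 1) ≠ ⊤ := measure_ball_lt_top.ne
  set q := volume X / volume (Metric.ball (0 : EuclideanSpace ℝ (Fin d)) 1) with hq
  have hqtop : q ≠ ⊤ := ENNReal.div_ne_top hcompact.measure_lt_top.ne hω.ne'
  have hqpos : 0 < q.toReal := ENNReal.toReal_pos (ENNReal.div_pos hXpos.ne' hω').ne' hqtop
  set v : ℝ := q.toReal / 2 ^ d with hv
  have hvpos : 0 < v := by positivity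
  have hvX : volume X =
      ENNReal.ofReal (v * 2 ^ d) * volume (Metric.ball (0 : EuclideanSpace ℝ (Fin d)) 1) := by
    rw [hv, div_mul_cancel₀ _ (by positivity), ENNReal.ofReal_toReal hqtop, hq,
      ENNReal.div_mul_cancel hω.ne' hω']
  -- `1 / 4` keeps `δ ≤ 1 / 4`; `256 = 2 * 128` combines the packing loss `2` with the `128` of
  -- `exists_regret_ge`.
  set a : ℝ := min (1 / 4) (v / 256) with ha
  have hapos : 0 < a := by positivity
  have ha4 : a ≤ 1 / 4 := min_le_left _ _
  have hav : a ≤ v / 256 := min_le_right _ _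
  refine ⟨a / 4, 1, by positivity, one_pos, fun G _ _ n hn S => ?_⟩
  set N : ℝ := (Nat.card G : ℝ) with hN
  have hN1 : 1 ≤ N := Nat.one_le_cast.2 Nat.card_pos
  rw [one_mul] at hn
  have hn1 : (1 : ℝ) ≤ n := (one_le_pow₀ hN1).trans hn
  set b : ℝ := (n * N) ^ ((1 : ℝ) / (d + 2)) with hb
  have hbpow : b ^ (d + 2) = n * N := by
    rw [hb, ← Real.rpow_natCast, ← Real.rpow_mul (by positivity)]
    push_cast
    rw [one_div, inv_mul_cancel₀ (by positivity), Real.rpow_one]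
  have hb0 : 0 ≤ b := by positivity
  -- The horizon condition enters here: `N ^ (d + 2) ≤ n * N = b ^ (d + 2)`. It makes `N * δ ^ d`
  -- small enough for the packing.
  have hbN : N ≤ b := by
    refine le_of_pow_le_pow_left₀ (n := d + 2) (by omega) hb0 ?_
    rw [hbpow, pow_succ N (d + 1)]
    gcongr
  have hb1 : 1 ≤ b := hN1.trans hbN
  have hbd : N ≤ b ^ d := hbN.trans (le_self_pow₀ hb1 (by omega))
  set δ : ℝ := a / b with hδ
  have hδpos : 0 < δ := by positivity
  have hδ4 : δ ≤ 1 / 4 := (div_le_self hapos.le hb1).trans ha4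
  have had : a ^ d ≤ a := pow_le_of_le_one hapos.le (by linarith) (by omega)
  have hNδ : N * δ ^ d ≤ a := by
    rw [hδ, div_pow, ← mul_div_assoc, div_le_iff₀ (by positivity)]
    calc N * a ^ d ≤ b ^ d * a := by gcongr
      _ = a * b ^ d := mul_comm _ _
  -- The choice of `b` makes this product exactly `a ^ (d + 2)`, independent of `n` and `G`.
  have hnδ : N * δ ^ d * (n * δ ^ 2) ≤ a := by
    have : N * δ ^ d * (n * δ ^ 2) = a ^ (d + 2) := by
      calc N * δ ^ d * (n * δ ^ 2) = (n * N) * δ ^ (d + 2) := by ring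
        _ = a ^ (d + 2) := by rw [← hbpow, ← mul_pow, hδ, mul_div_cancel₀ _ (by positivity)]
    rw [this]
    exact pow_le_of_le_one hapos.le (by linarith) (by omega)
  obtain ⟨s, hs4, hsv, hsX, hs⟩ := exists_card_separated_orbits hvpos hvX G hδpos
    (by rw [mul_assoc]; linarith)
  have hmeas (p : EuclideanSpace ℝ (Fin d)) : Measurable fun x : X => orbitBump G δ p x :=
    ((continuous_orbitBump G δ p).comp continuous_subtype_val).measurable
  obtain ⟨p, hp, hreg⟩ := Bandit.exists_regret_ge (s := s)
    (fun p (x : X) => orbitBump G δ p x) hmeas hδ4 (fun p x => orbitBump_nonneg G δ p x)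
    (fun p hp => ⟨⟨p, hsX hp⟩, orbitBump_self G hδpos.le p⟩)
    (fun p x => orbitBump_le G hδpos.le p x) (fun x => sum_orbitBump_le G hδpos.le hs x) hs4 S n (by
      have h0 : 0 < N * δ ^ d := by positivity
      refine le_of_mul_le_mul_left ?_ h0
      linarith)
  have habs (x : X) : |orbitBump G δ p x| ≤ 1 / 2 := by
    rw [abs_of_nonneg (orbitBump_nonneg G δ p x)]
    linarith [orbitBump_le G hδpos.le p (x : EuclideanSpace ℝ (Fin d))]
  refine ⟨_, ⟨Bandit.isMarkovKernel_bernoulliKernel (hmeas p) habs, fun x y => ?_,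
    fun g hg x y hxy => ?_⟩, le_trans (le_of_eq ?_) hreg⟩
  · simp only [Bandit.meanReward_bernoulliKernel (hmeas p) habs, add_sub_add_left_eq_sub]
    exact abs_orbitBump_sub_le G δ p x y
  · simp only [Bandit.meanReward_bernoulliKernel (hmeas p) habs, hxy, orbitBump_apply G hg]
  · have h1 : (n : ℝ) ^ (((d : ℝ) + 1) / (d + 2)) = n / (n : ℝ) ^ ((1 : ℝ) / (d + 2)) := by
      rw [eq_div_iff (by positivity), ← Real.rpow_add (by positivity), ← add_div, add_assoc,
        one_add_one_eq_two, div_self (by positivity), Real.rpow_one]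
    rw [h1, hδ, hb, Real.mul_rpow (by positivity) (by positivity),
      Real.div_rpow one_pos.le (by positivity), Real.one_rpow]
    field_simp
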